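/- Let $u\ge 1$, let $f=(f_1,\dots,f_u)$ be a tuple of non-constant rational maps of the Riemann sphere $\hat{\mathbb C}$, and let $G=\langle f_1,\dots,f_u\rangle=\{f_{\omega_n}\circ\cdots\circ f_{\omega_1}: n\ge 1,\ \omega\in\{1,\dots,u\}^n\}$. Let $F(G)$ be the set of points of $\hat{\mathbb C}$ having a neighbourhood on which $G$ is a normal family, and let $J(G)=\hat{\mathbb C}\setminus F(G)$. Write $\mathrm{Crit}(g)$ for the set of critical points of a rational map $g$, and put $$\mathrm{PCV}(G)=\overline{\bigcup_{g\in G\cup\{\mathrm{Id}\}}\ \bigcup_{j=1}^u g\big(f_j(\mathrm{Crit}(f_j))\big)},\qquad \mathrm{Crit}_*(f)=\bigcup_{j=1}^u\{c\in\mathrm{Crit}(f_j): f_j(c)\in J(G)\}.$$ Assume that $G$ is totally non-recurrent (TNR), that is: (i) some element of $G$ has degree at least $2$; every Möbius map in $G$ is loxodromic (conjugate by a Möbius map to $z\mapsto\lambda z$ with $\lambda\neq0$, $|\lambda|\ne 1$); and $F(G)\neq\emptyset$; (ii) each $z\in J(G)$ has a neighbourhood $U$ such that for every sequence $(g_n)$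 in $G$, every non-empty domain $V\subset\hat{\mathbb C}$ and every $\zeta\in U$, the sequence $(g_n)$ does not converge to the constant $\zeta$ locally uniformly on $V$; (iii) $\mathrm{Crit}_*(f)\cap \mathrm{PCV}(G)=\emptyset$. Assume also that $f$ satisfies the Nice Open Set Condition, that is, there is a non-empty open set $U\subset\hat{\mathbb C}$ such that $\bigcup_{i} f_i^{-1}(U)\subset U$, $f_i^{-1}(U)\cap f_j^{-1}(U)=\emptyset$ whenever $i\neq j$, and for some $\alpha\in(0,1)$ $$l_2(U\cap B_s(x,r))\ge\alpha\, l_2(B_s(x,r))\qquad\text{for all } x\in\overline U \text{ and all } 0<r\le 1,$$ where $B_s(x,r)$ is the ball for the spherical distance and $l_2$ is the spherical area. Let $\Sigma_u=\{1,\dots,u\}^{\mathbb N}$ with the product topology, and let $\tilde f:\Sigma_u\times\hat{\mathbb C}\to\Sigma_u\times\hat{\mathbb C}$, $\tilde f(\omega,z)=(\sigma(\omega),f_{\omega_1}(z))$, be the skew product, where $\sigma$ is the shift. For $\omega\in\Sigma_u$ let $J_\omega$ be the set of points $z\in\hat{\mathbb C}$ such that the family $\{f_{\omega_n}\circ\cdots\circ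 f_{\omega_1}: n\ge1\}$ is not normal in any neighbourhood of $z$, and let $$J(\tilde f)=\overline{\bigcup_{\omega\in\Sigma_u}\{\omega\}\times J_\omega}\subset\Sigma_u\times\hat{\mathbb C}.$$ Then $G$ is of finite type, i.e. the set $$\mathrm{Crit}_*(\tilde f)=\{(\omega,c)\in J(\tilde f): f_{\omega_1}'(c)=0\}$$ of the critical points of $\tilde f$ that lie in $J(\tilde f)$ is finite. -/

import Mathlib

namespace RationalSemigroup

noncomputable section

open Set Filter Topology OnePoint
open scoped Polynomial

/-! ### The Riemann sphere -/

/-- The Riemann sphere, with its topology as the one-point compactification of `ℂ`. -/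
abbrev RSphere : Type := OnePoint ℂ

/-- The unique uniform structure on the compact Hausdorff space `RSphere`; it induces the topology
of the sphere and is the uniform structure of the spherical metric. -/
instance instUniformSpaceRSphere : UniformSpace RSphere := uniformSpaceOfCompactR1

/-- The chordal distance of the sphere of radius one. -/
def chordalDist : RSphere → RSphere → ℝ
  | ∞, ∞ => 0
  | ∞, (w : ℂ) => 2 / √(1 + ‖w‖ ^ 2)
  | (z : ℂ), ∞ => 2 / √(1 + ‖z‖ ^ 2)
  | (z : ℂ), (w : ℂ) => 2 * ‖z - w‖ / (√(1 + ‖z‖ ^ 2) * √(1 + ‖w‖ ^ 2))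

/-- The spherical distance: the geodesic distance of the metric `2 |dz| / (1 + |z|²)`. -/
def sphericalDist (x y : RSphere) : ℝ := 2 * Real.arcsin (chordalDist x y / 2)

/-- The open ball of radius `r` about `x` for the spherical distance. -/
def sphericalBall (x : RSphere) (r : ℝ) : Set RSphere := {y | sphericalDist y x < r}

/-- Two-dimensional Lebesgue measure on the sphere: the area `4 dx dy / (1 + |z|²)²`, for which the
point at infinity is a null set. -/
def sphericalArea (A : Set RSphere) : ENNReal :=
  ∫⁻ z in ((↑) : ℂ → RSphere) ⁻¹' A, ENNReal.ofReal (4 / (1 + ‖z‖ ^ 2) ^ 2)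

/-- The map `z ↦ 1 / z` of the sphere. -/
def sphereInv : RSphere → RSphere
  | ∞ => ((0 : ℂ) : RSphere)
  | (z : ℂ) => if z = 0 then ∞ else ((z⁻¹ : ℂ) : RSphere)

/-- The affine coordinate `z` (with the irrelevant value `0` at `∞`). -/
def affineCoord : RSphere → ℂ
  | ∞ => 0
  | (z : ℂ) => z

/-- A standard holomorphic coordinate near `a`: `z` if `a ≠ ∞`, and `1 / z` if `a = ∞`. -/
def coordAt : RSphere → RSphere → ℂ
  | ∞, x => affineCoord (sphereInv x)
  | (_ : ℂ), x => affineCoord x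

/-- The inverse of the coordinate `coordAt a`. -/
def coordAtSymm : RSphere → ℂ → RSphere
  | ∞, w => sphereInv (w : RSphere)
  | (_ : ℂ), w => (w : RSphere)

/-- `c` is a critical point of `g`: the derivative of `g` at `c`, computed in holomorphic
coordinates near `c` and near `g c`, exists and vanishes. -/
def IsCriticalPoint (g : RSphere → RSphere) (c : RSphere) : Prop :=
  HasDerivAt (fun w : ℂ => coordAt (g c) (g (coordAtSymm c w))) 0 (coordAt c c)

/-! ### Rational maps -/

/-- The self-map of the sphere given by the fraction `p / q` (for coprime `p` and `q`, not both
constant). -/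
def fractionMap (p q : ℂ[X]) : RSphere → RSphere
  | ∞ =>
    if q.coeff (max p.natDegree q.natDegree) = 0 then ∞
    else ((p.coeff (max p.natDegree q.natDegree) / q.coeff (max p.natDegree q.natDegree) : ℂ) :
      RSphere)
  | (z : ℂ) => if q.eval z = 0 then ∞ else ((p.eval z / q.eval z : ℂ) : RSphere)

/-- `g` is a rational map of degree `d`. -/
def IsRationalOfDegree (d : ℕ) (g : RSphere → RSphere) : Prop :=
  ∃ p q : ℂ[X], IsCoprime p q ∧ max p.natDegree q.natDegree = d ∧ g = fractionMap p q

/-- `g` is a non-constant rational map of the Riemann sphere. -/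
def IsRationalMap (g : RSphere → RSphere) : Prop :=
  ∃ d : ℕ, 1 ≤ d ∧ IsRationalOfDegree d g

/-- `g` is a loxodromic Möbius map: it is conjugate, by a Möbius map `h`, to `z ↦ l * z` for a
complex number `l ≠ 0` with `|l| ≠ 1`. -/
def IsLoxodromic (g : RSphere → RSphere) : Prop :=
  ∃ (h : RSphere → RSphere) (l : ℂ), IsRationalOfDegree 1 h ∧ l ≠ 0 ∧ ‖l‖ ≠ 1 ∧
    ∀ x, h (g x) = fractionMap (Polynomial.C l * Polynomial.X) 1 (h x)

/-! ### Fatou and Julia sets -/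

/-- The family `H` is normal on `W`: every sequence in `H` has a subsequence that converges
locally uniformly on `W`. -/
def IsNormalOn (H : Set (RSphere → RSphere)) (W : Set RSphere) : Prop :=
  ∀ g : ℕ → RSphere → RSphere, (∀ n, g n ∈ H) →
    ∃ (k : ℕ → ℕ) (h : RSphere → RSphere), StrictMono k ∧
      TendstoLocallyUniformlyOn (fun n => g (k n)) h atTop W

/-- The set of points that have a neighbourhood on which `H` is normal. -/
def fatouSet (H : Set (RSphere → RSphere)) : Set RSphere :=
  {z | ∃ W : Set RSphere, IsOpen W ∧ z ∈ W ∧ IsNormalOn H W}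

/-- The complement of the Fatou set. -/
def juliaSet (H : Set (RSphere → RSphere)) : Set RSphere := (fatouSet H)ᶜ

/-! ### The semigroup generated by a multi-map -/

/-- The semigroup `⟨f₁, …, f_u⟩` under composition. -/
def genSemigroup {u : ℕ} (f : Fin u → RSphere → RSphere) : Set (RSphere → RSphere) :=
  {g | (g : Function.End RSphere) ∈
    Subsemigroup.closure {h : Function.End RSphere | ∃ j, h = f j}}

/-- The postcritical set `PCV(G)`: the closure of `G^*(Crit(f)_+)`, where `G^* = G ∪ {Id}` and
`Crit(f)_+` is the set of the critical values of the generators. -/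
def postcriticalSet {u : ℕ} (f : Fin u → RSphere → RSphere) : Set RSphere :=
  closure {z | ∃ g ∈ genSemigroup f ∪ {id}, ∃ (j : Fin u) (c : RSphere),
    IsCriticalPoint (f j) c ∧ z = g (f j c)}

/-- `Crit_*(f)`: the critical points `c` of some generator `f_j` with `f_j(c) ∈ J(G)`. -/
def critStar {u : ℕ} (f : Fin u → RSphere → RSphere) : Set RSphere :=
  {c | ∃ j : Fin u, IsCriticalPoint (f j) c ∧ f j c ∈ juliaSet (genSemigroup f)}

/-- The semigroup `G` generated by the multi-map `f` is totally non-recurrent (TNR). -/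
structure IsTNR {u : ℕ} (f : Fin u → RSphere → RSphere) : Prop where
  /-- Some element of `G` has degree at least two. -/
  exists_degree : ∃ g ∈ genSemigroup f, ∃ d : ℕ, 2 ≤ d ∧ IsRationalOfDegree d g
  /-- Every Möbius map in `G` is loxodromic. -/
  loxodromic : ∀ g ∈ genSemigroup f, IsRationalOfDegree 1 g → IsLoxodromic g
  /-- The Fatou set of `G` is not empty. -/
  fatou_nonempty : (fatouSet (genSemigroup f)).Nonempty
  /-- Each point of `J(G)` has a neighbourhood no point of which is the locally uniform limit, on
  some domain, of a sequence in `G`. -/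
  no_constant_limit : ∀ z ∈ juliaSet (genSemigroup f), ∃ U ∈ 𝓝 z,
    ∀ g : ℕ → RSphere → RSphere, (∀ n, g n ∈ genSemigroup f) →
      ∀ V : Set RSphere, IsOpen V → IsConnected V → ∀ ζ ∈ U,
        ¬ TendstoLocallyUniformlyOn g (fun _ => ζ) atTop V
  /-- `Crit_*(f) ∩ PCV(G) = ∅`. -/
  critStar_inter : critStar f ∩ postcriticalSet f = ∅

/-- The Nice Open Set Condition for the multi-map `f`. -/
def NiceOpenSetCondition {u : ℕ} (f : Fin u → RSphere → RSphere) : Prop :=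
  ∃ U : Set RSphere, IsOpen U ∧ U.Nonempty ∧
    (⋃ i, f i ⁻¹' U) ⊆ U ∧
    (∀ i j, i ≠ j → f i ⁻¹' U ∩ f j ⁻¹' U = ∅) ∧
    ∃ α : ℝ, 0 < α ∧ α < 1 ∧ ∀ r : ℝ, 0 < r → r ≤ 1 → ∀ x ∈ closure U,
      ENNReal.ofReal α * sphericalArea (sphericalBall x r) ≤
        sphericalArea (U ∩ sphericalBall x r)

/-! ### The skew product -/

/-- The skew product map `(ω, z) ↦ (σ ω, f_{ω₁}(z))` on `Σ_u × Ĉ`; sequences are indexed from `0`,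
so that `ω 0` is the first letter. -/
def skewProduct {u : ℕ} (f : Fin u → RSphere → RSphere) (ξ : (ℕ → Fin u) × RSphere) :
    (ℕ → Fin u) × RSphere :=
  (fun n => ξ.1 (n + 1), f (ξ.1 0) ξ.2)

/-- The map `f_{ω|n} = f_{ω_n} ∘ ⋯ ∘ f_{ω_1}`, the action of the `n`-th iterate of the skew
product from the fibre over `ω`. -/
def fibreMap {u : ℕ} (f : Fin u → RSphere → RSphere) (ω : ℕ → Fin u) (n : ℕ) (z : RSphere) :
    RSphere :=
  ((skewProduct f)^[n] (ω, z)).2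

/-- The fibre Julia set `J_ω`: the set of non-normality of `{f_{ω|n} : n ≥ 1}`. -/
def fibreJuliaSet {u : ℕ} (f : Fin u → RSphere → RSphere) (ω : ℕ → Fin u) : Set RSphere :=
  juliaSet {g | ∃ n : ℕ, 1 ≤ n ∧ g = fibreMap f ω n}

/-- The Julia set of the skew product: the closure of `⋃_ω {ω} × J_ω` in `Σ_u × Ĉ`. -/
def skewJuliaSet {u : ℕ} (f : Fin u → RSphere → RSphere) : Set ((ℕ → Fin u) × RSphere) :=
  closure {ξ | ξ.2 ∈ fibreJuliaSet f ξ.1}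

/-- The critical points of the skew product: the pairs `(ω, c)` with `f_{ω₁}'(c) = 0`. -/
def skewCrit {u : ℕ} (f : Fin u → RSphere → RSphere) : Set ((ℕ → Fin u) × RSphere) :=
  {ξ | IsCriticalPoint (f (ξ.1 0)) ξ.2}

/-- `Crit_*` of the skew product: its critical points that lie in its Julia set. -/
def skewCritStar {u : ℕ} (f : Fin u → RSphere → RSphere) : Set ((ℕ → Fin u) × RSphere) :=
  skewJuliaSet f ∩ skewCrit f

/-- The semigroup generated by `f` is of finite type. -/
def IsOfFiniteType {u : ℕ} (f : Fin u → RSphere → RSphere) : Prop :=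
  (skewCritStar f).Finite

end

end RationalSemigroup

namespace RationalSemigroup

noncomputable section

open Set Filter Topology OnePoint
open scoped Polynomial

/-! ### Charts of the sphere -/

/-! A critical point of the skew product is a pair (ω, c) with c critical for f_j, where j is the
first letter of ω. Since each generator has finitely many critical points, it is enough to bound,
for each critical value v = f_j(c), the number of tails τ along which the orbit of v stays in J(G);
every tail arising from the skew Julia set has this property.

The bound is a packing argument. Given finitely many such tails, choose n so large that their
prefixes of length n differ. With U the open set of the Nice Open Set Condition, the sets
f_{τ|n}⁻¹(U) are then pairwise disjoint (`disjoint_preimage_fibreMap`). The orbit of v stays in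
PCV(G) and in J(G), so Crit_* ∩ PCV(G) = ∅ makes each f_{τ|n} locally invertible at v
(`deriv_chartMap_fibreMap_ne_zero`). Moreover f_{τ|n}(v) lies in J(G), hence in the closure of U
(`juliaSet_subset_closure`), so U has lower density at least a fixed multiple of α there. A locally
invertible holomorphic map pulls this density back to v with a loss independent of the map
(`HasLowerDensityAt.preimage`). Thus every f_{τ|n}⁻¹(U) fills a proportion β of all small discs
about v, with β independent of τ and n, and there are at most 1/β tails.

The inclusion of J(G) in the closure of U is an elementary case of Montel's theorem: G maps the
complement of U into itself, so off the closure of U it omits an open set. -/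

@[simp] theorem sphereInv_infty : sphereInv ∞ = ((0 : ℂ) : RSphere) := rfl

theorem sphereInv_coe (z : ℂ) :
    sphereInv (z : RSphere) = if z = 0 then ∞ else ((z⁻¹ : ℂ) : RSphere) := rfl

@[simp] theorem sphereInv_zero : sphereInv ((0 : ℂ) : RSphere) = ∞ := by simp [sphereInv_coe]

theorem sphereInv_coe_of_ne {z : ℂ} (hz : z ≠ 0) :
    sphereInv (z : RSphere) = ((z⁻¹ : ℂ) : RSphere) := by simp [sphereInv_coe, hz]

@[simp] theorem affineCoord_coe (z : ℂ) : affineCoord (z : RSphere) = z := rfl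

@[simp] theorem coordAt_coe (a : ℂ) (x : RSphere) : coordAt (a : RSphere) x = affineCoord x := rfl

@[simp] theorem coordAt_infty (x : RSphere) : coordAt ∞ x = affineCoord (sphereInv x) := rfl

@[simp] theorem coordAtSymm_coe (a w : ℂ) : coordAtSymm (a : RSphere) w = (w : RSphere) := rfl

@[simp] theorem coordAtSymm_infty (w : ℂ) : coordAtSymm ∞ w = sphereInv (w : RSphere) := rfl

@[simp] theorem sphereInv_sphereInv (x : RSphere) : sphereInv (sphereInv x) = x := by
  induction x using OnePoint.rec with
  | infty => simp
  | coe z =>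
    rcases eq_or_ne z 0 with rfl | hz
    · simp
    · simp [sphereInv_coe_of_ne hz, sphereInv_coe_of_ne (inv_ne_zero hz)]

theorem continuous_sphereInv : Continuous sphereInv := by
  rw [continuous_iff_continuousAt]
  intro x
  induction x using OnePoint.rec with
  | infty =>
    rw [continuousAt_infty', coclosedCompact_eq_cocompact, ← Metric.cobounded_eq_cocompact]
    have h : Tendsto (fun z : ℂ => ((z⁻¹ : ℂ) : RSphere)) (Bornology.cobounded ℂ)
        (𝓝 ((0 : ℂ) : RSphere)) :=
      (OnePoint.continuous_coe.tendsto 0).comp tendsto_inv₀_cobounded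
    refine h.congr' ?_
    filter_upwards [Bornology.eventually_ne_cobounded (0 : ℂ)] with z hz
    simp [sphereInv_coe_of_ne hz]
  | coe z =>
    rw [continuousAt_coe]
    rcases eq_or_ne z 0 with rfl | hz
    · rw [continuousAt_iff_punctured_nhds]
      have h : Tendsto (fun z : ℂ => ((z⁻¹ : ℂ) : RSphere)) (𝓝[≠] 0) (𝓝 ∞) := by
        refine tendsto_coe_infty.comp ?_
        rw [coclosedCompact_eq_cocompact, ← Metric.cobounded_eq_cocompact]
        exact tendsto_inv₀_nhdsNE_zero
      simp only [Function.comp_apply, sphereInv_zero]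
      refine h.congr' ?_
      filter_upwards [self_mem_nhdsWithin] with z hz
      simp [sphereInv_coe_of_ne hz]
    · have h : ContinuousAt (fun z : ℂ => ((z⁻¹ : ℂ) : RSphere)) z :=
        OnePoint.continuous_coe.continuousAt.comp (continuousAt_inv₀ hz)
      refine h.congr ?_
      filter_upwards [isOpen_ne.mem_nhds hz] with w hw
      simp [sphereInv_coe_of_ne hw]

/-- The inversion as a homeomorphism. -/
def sphereInvHomeomorph : RSphere ≃ₜ RSphere where
  toFun := sphereInv
  invFun := sphereInv
  left_inv := sphereInv_sphereInv
  right_inv := sphereInv_sphereInv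
  continuous_toFun := continuous_sphereInv
  continuous_invFun := continuous_sphereInv

theorem isOpenEmbedding_coordAtSymm (a : RSphere) : IsOpenEmbedding (coordAtSymm a) := by
  induction a using OnePoint.rec with
  | infty => exact sphereInvHomeomorph.isOpenEmbedding.comp isOpenEmbedding_coe
  | coe a => exact isOpenEmbedding_coe

@[simp] theorem coordAt_coordAtSymm (a : RSphere) (w : ℂ) : coordAt a (coordAtSymm a w) = w := by
  induction a using OnePoint.rec <;> simp

@[simp] theorem coordAtSymm_coordAt_self (a : RSphere) : coordAtSymm a (coordAt a a) = a := by
  induction a using OnePoint.rec <;> simp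

theorem map_coordAtSymm_nhds (a : RSphere) : map (coordAtSymm a) (𝓝 (coordAt a a)) = 𝓝 a := by
  rw [(isOpenEmbedding_coordAtSymm a).map_nhds_eq, coordAtSymm_coordAt_self]

theorem eventually_coordAtSymm_coordAt (a : RSphere) :
    ∀ᶠ x in 𝓝 a, coordAtSymm a (coordAt a x) = x := by
  rw [← map_coordAtSymm_nhds, eventually_map]
  simp

theorem continuousAt_coordAt (a : RSphere) : ContinuousAt (coordAt a) a := by
  unfold ContinuousAt
  nth_rewrite 1 [← map_coordAtSymm_nhds a]
  rw [tendsto_map'_iff]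
  simp only [Function.comp_def, coordAt_coordAtSymm]
  exact tendsto_id

/-! ### Holomorphic maps of the sphere -/

/-- The expression of `g` in the standard coordinates near `c` and `g c`. -/
def chartMap (g : RSphere → RSphere) (c : RSphere) (w : ℂ) : ℂ :=
  coordAt (g c) (g (coordAtSymm c w))

/-- `g` is continuous at `c`, and analytic in the standard coordinates near `c` and `g c`. -/
def IsHolomorphicAt (g : RSphere → RSphere) (c : RSphere) : Prop :=
  ContinuousAt g c ∧ AnalyticAt ℂ (chartMap g c) (coordAt c c)

theorem chartMap_coordAt (g : RSphere → RSphere) (c : RSphere) :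
    chartMap g c (coordAt c c) = coordAt (g c) (g c) := by simp [chartMap]

theorem IsHolomorphicAt.tendsto {g : RSphere → RSphere} {c : RSphere} (hg : IsHolomorphicAt g c) :
    Tendsto (fun w => g (coordAtSymm c w)) (𝓝 (coordAt c c)) (𝓝 (g c)) := by
  refine hg.1.tendsto.comp ?_
  rw [← map_coordAtSymm_nhds c]
  exact tendsto_map

/-- Continuity keeps g inside the chart about g c, where `coordAtSymm` undoes `coordAt`; so
`chartMap` determines g near c. -/
theorem IsHolomorphicAt.eventually_eq {g : RSphere → RSphere} {c : RSphere}
    (hg : IsHolomorphicAt g c) :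
    ∀ᶠ w in 𝓝 (coordAt c c), g (coordAtSymm c w) = coordAtSymm (g c) (chartMap g c w) :=
  (hg.tendsto.eventually (eventually_coordAtSymm_coordAt (g c))).mono fun _ h => h.symm

/-- The assumed identity is between points of the sphere, so it yields continuity too. Analyticity
of `chartMap` alone would not: `affineCoord` gives ∞ the default value 0. -/
theorem isHolomorphicAt_of_eventuallyEq {g : RSphere → RSphere} {c : RSphere} {h : ℂ → ℂ}
    (hh : AnalyticAt ℂ h (coordAt c c))
    (heq : ∀ᶠ w in 𝓝 (coordAt c c), g (coordAtSymm c w) = coordAtSymm (g c) (h w)) :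
    IsHolomorphicAt g c ∧ chartMap g c =ᶠ[𝓝 (coordAt c c)] h := by
  have h1 : chartMap g c =ᶠ[𝓝 (coordAt c c)] h := by
    filter_upwards [heq] with w hw
    simp [chartMap, hw]
  have h2 : h (coordAt c c) = coordAt (g c) (g c) := by
    rw [← h1.eq_of_nhds, chartMap_coordAt]
  refine ⟨⟨?_, hh.congr h1.symm⟩, h1⟩
  unfold ContinuousAt
  nth_rewrite 1 [← map_coordAtSymm_nhds c]
  rw [tendsto_map'_iff]
  have h3 : Tendsto (fun w => coordAtSymm (g c) (h w)) (𝓝 (coordAt c c)) (𝓝 (g c)) := by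
    have := ((isOpenEmbedding_coordAtSymm (g c)).continuous.tendsto _).comp
      hh.continuousAt.tendsto
    rwa [h2, coordAtSymm_coordAt_self] at this
  exact h3.congr' (heq.mono fun _ h => h.symm)

theorem chartMap_comp {g h : RSphere → RSphere} {c : RSphere} (hh : IsHolomorphicAt h c) :
    chartMap (g ∘ h) c =ᶠ[𝓝 (coordAt c c)] chartMap g (h c) ∘ chartMap h c := by
  filter_upwards [hh.eventually_eq] with w hw
  change coordAt (g (h c)) (g (h (coordAtSymm c w))) =
    coordAt (g (h c)) (g (coordAtSymm (h c) (chartMap h c w)))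
  rw [hw]

theorem IsHolomorphicAt.comp {g h : RSphere → RSphere} {c : RSphere}
    (hg : IsHolomorphicAt g (h c)) (hh : IsHolomorphicAt h c) : IsHolomorphicAt (g ∘ h) c := by
  refine ⟨hg.1.comp hh.1, AnalyticAt.congr ?_ (chartMap_comp hh).symm⟩
  refine AnalyticAt.comp ?_ hh.2
  rw [chartMap_coordAt]
  exact hg.2

theorem isHolomorphicAt_id (c : RSphere) : IsHolomorphicAt id c ∧
    deriv (chartMap id c) (coordAt c c) = 1 := by
  have h : chartMap id c = id := by ext w; simp [chartMap]
  rw [IsHolomorphicAt, h]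
  exact ⟨⟨continuousAt_id, analyticAt_id⟩, by simp⟩

theorem deriv_chartMap_comp {g h : RSphere → RSphere} {c : RSphere}
    (hg : IsHolomorphicAt g (h c)) (hh : IsHolomorphicAt h c) :
    deriv (chartMap (g ∘ h) c) (coordAt c c) =
      deriv (chartMap g (h c)) (coordAt (h c) (h c)) * deriv (chartMap h c) (coordAt c c) := by
  rw [(chartMap_comp hh).deriv_eq, deriv_comp]
  · rw [chartMap_coordAt]
  · rw [chartMap_coordAt]
    exact hg.2.differentiableAt
  · exact hh.2.differentiableAt

theorem IsHolomorphicAt.isCriticalPoint_iff {g : RSphere → RSphere} {c : RSphere}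
    (hg : IsHolomorphicAt g c) :
    IsCriticalPoint g c ↔ deriv (chartMap g c) (coordAt c c) = 0 := by
  change HasDerivAt (chartMap g c) 0 (coordAt c c) ↔ _
  refine ⟨fun h => h.deriv, fun h => ?_⟩
  rw [← h]
  exact hg.2.differentiableAt.hasDerivAt

/-! ### Rational maps are holomorphic -/

theorem fractionMap_coe (p q : ℂ[X]) (z : ℂ) : fractionMap p q (z : RSphere) =
    if q.eval z = 0 then ∞ else ((p.eval z / q.eval z : ℂ) : RSphere) := rfl

theorem sphereInv_fractionMap_coe {p q : ℂ[X]} {z : ℂ} (h : ¬(p.eval z = 0 ∧ q.eval z = 0)) :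
    sphereInv (fractionMap p q (z : RSphere)) = fractionMap q p (z : RSphere) := by
  rw [fractionMap_coe, fractionMap_coe]
  by_cases hq : q.eval z = 0
  · have hp : p.eval z ≠ 0 := fun hp => h ⟨hp, hq⟩
    simp [hp, hq]
  · by_cases hp : p.eval z = 0
    · simp [hp, hq]
    · simp [hp, hq, sphereInv_coe]

theorem deriv_eval_div_eval {p q : ℂ[X]} {z : ℂ} (hq : q.eval z ≠ 0) :
    deriv (fun w => p.eval w / q.eval w) z =
      (p.derivative * q - p * q.derivative).eval z / q.eval z ^ 2 := by
  have := (p.hasDerivAt z).div (q.hasDerivAt z) hq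
  rw [show (fun w => p.eval w / q.eval w) = (fun w => p.eval w) / fun w => q.eval w from rfl,
    this.deriv]
  simp

/-- The local expression is p/q away from the poles and q/p at a pole; the numerators of the two
derivatives are the Wronskian p'q - pq' and its negative, so one polynomial detects the critical
points in both cases. -/
theorem exists_analyticAt_fractionMap_coe {p q : ℂ[X]} {z : ℂ}
    (h : ¬(p.eval z = 0 ∧ q.eval z = 0)) :
    ∃ k : ℂ → ℂ, AnalyticAt ℂ k z ∧
      (∀ᶠ w : ℂ in 𝓝 z, fractionMap p q (w : RSphere) =
        coordAtSymm (fractionMap p q (z : RSphere)) (k w)) ∧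
      (deriv k z = 0 → (p.derivative * q - p * q.derivative).eval z = 0) := by
  have an (r : ℂ[X]) : AnalyticAt ℂ (fun w => r.eval w) z :=
    r.differentiable.analyticAt z
  by_cases hq : q.eval z = 0
  · have hp : p.eval z ≠ 0 := fun hp => h ⟨hp, hq⟩
    refine ⟨fun w => q.eval w / p.eval w, (an q).div (an p) hp, ?_, fun h0 => ?_⟩
    · filter_upwards [p.continuous.continuousAt.eventually_ne hp] with w hw
      rw [fractionMap_coe p q z, if_pos hq, coordAtSymm_infty]
      have := sphereInv_fractionMap_coe (p := q) (q := p) (z := w) (fun h => hw h.2)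
      rw [← this, fractionMap_coe, if_neg hw]
    · rw [deriv_eval_div_eval hp, div_eq_zero_iff, or_iff_left (pow_ne_zero 2 hp)] at h0
      simp only [Polynomial.eval_sub, Polynomial.eval_mul] at h0 ⊢
      linear_combination -h0
  · refine ⟨fun w => p.eval w / q.eval w, (an p).div (an q) hq, ?_, fun h0 => ?_⟩
    · filter_upwards [q.continuous.continuousAt.eventually_ne hq] with w hw
      rw [fractionMap_coe p q z, if_neg hq, coordAtSymm_coe, fractionMap_coe, if_neg hw]
    · rwa [deriv_eval_div_eval hq, div_eq_zero_iff, or_iff_left (pow_ne_zero 2 hq)] at h0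

theorem isCoprime_not_eval_eq_zero {p q : ℂ[X]} (h : IsCoprime p q) (z : ℂ) :
    ¬(p.eval z = 0 ∧ q.eval z = 0) := by
  rintro ⟨hp, hq⟩
  obtain ⟨a, b, hab⟩ := h
  simpa [hp, hq] using congrArg (Polynomial.eval z) hab

theorem eval_reflect {p : ℂ[X]} {d : ℕ} (hp : p.natDegree ≤ d) {w : ℂ} (hw : w ≠ 0) :
    (p.reflect d).eval w = w ^ d * p.eval w⁻¹ := by
  have := invertibleOfNonzero (inv_ne_zero hw)
  have h := Polynomial.eval₂_reflect_mul_pow (RingHom.id ℂ) w⁻¹ d p hp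
  simp only [invOf_eq_inv, inv_inv, Polynomial.eval₂_id] at h
  rw [← h, mul_left_comm, ← mul_pow, mul_inv_cancel₀ hw, one_pow, mul_one]

/-- Substituting 1/w and clearing w^d reverses the coefficients; this reduces the behaviour at ∞ to
that of another fraction at 0. -/
theorem fractionMap_sphereInv {p q : ℂ[X]} (w : ℂ) :
    fractionMap p q (sphereInv (w : RSphere)) =
      fractionMap (p.reflect (max p.natDegree q.natDegree))
        (q.reflect (max p.natDegree q.natDegree)) (w : RSphere) := by
  rcases eq_or_ne w 0 with rfl | hw
  · rw [sphereInv_zero, fractionMap_coe]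
    simp only [← Polynomial.coeff_zero_eq_eval_zero, Polynomial.coeff_reflect,
      Polynomial.revAt_zero]
    rfl
  · rw [sphereInv_coe_of_ne hw, fractionMap_coe, fractionMap_coe, eval_reflect (le_max_left _ _) hw,
      eval_reflect (le_max_right _ _) hw]
    have hd : w ^ max p.natDegree q.natDegree ≠ 0 := pow_ne_zero _ hw
    simp [hd, mul_div_mul_left]

theorem IsRationalMap.isHolomorphicAt {g : RSphere → RSphere} (hg : IsRationalMap g)
    (c : RSphere) : IsHolomorphicAt g c := by
  obtain ⟨d, hd, p, q, hpq, hmax, rfl⟩ := hg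
  induction c using OnePoint.rec with
  | coe z =>
    obtain ⟨k, hk, heq, -⟩ := exists_analyticAt_fractionMap_coe (isCoprime_not_eval_eq_zero hpq z)
    exact (isHolomorphicAt_of_eventuallyEq (by simpa using hk) (by simpa using heq)).1
  | infty =>
    -- At 0 the reflected polynomials take the coefficients of degree d as values. One of these is a
    -- leading coefficient, nonzero because d ≥ 1.
    have h0 : ¬((p.reflect (max p.natDegree q.natDegree)).eval 0 = 0 ∧
        (q.reflect (max p.natDegree q.natDegree)).eval 0 = 0) := by
      simp only [← Polynomial.coeff_zero_eq_eval_zero, Polynomial.coeff_reflect,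
        Polynomial.revAt_zero]
      rintro ⟨h1, h2⟩
      rcases max_choice p.natDegree q.natDegree with h | h <;> rw [h] at h1 h2 hmax
      · rw [Polynomial.coeff_natDegree, Polynomial.leadingCoeff_eq_zero] at h1
        rw [h1, Polynomial.natDegree_zero] at hmax
        omega
      · rw [Polynomial.coeff_natDegree, Polynomial.leadingCoeff_eq_zero] at h2
        rw [h2, Polynomial.natDegree_zero] at hmax
        omega
    obtain ⟨k, hk, heq, -⟩ := exists_analyticAt_fractionMap_coe h0
    refine (isHolomorphicAt_of_eventuallyEq (h := k) (by simpa using hk) ?_).1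
    simp only [coordAt_infty, sphereInv_infty, affineCoord_coe, coordAtSymm_infty]
    filter_upwards [heq] with w hw
    rw [fractionMap_sphereInv, hw, ← fractionMap_sphereInv, sphereInv_zero]

theorem IsRationalMap.continuous {g : RSphere → RSphere} (hg : IsRationalMap g) : Continuous g :=
  continuous_iff_continuousAt.2 fun c => (hg.isHolomorphicAt c).1

/-- If p'q = pq' with p and q coprime, then p divides p', which has smaller degree unless p is
constant; the same holds for q. -/
theorem derivative_mul_sub_ne_zero {p q : ℂ[X]} (hpq : IsCoprime p q)
    (hd : 1 ≤ max p.natDegree q.natDegree) : p.derivative * q - p * q.derivative ≠ 0 := by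
  intro h
  have h1 : p.derivative * q = p * q.derivative := sub_eq_zero.1 h
  have key (r s : ℂ[X]) (hrs : IsCoprime r s) (h : r.derivative * s = r * s.derivative) :
      r.natDegree = 0 := by
    have hdvd : r ∣ r.derivative := hrs.dvd_of_dvd_mul_right (Dvd.intro _ h.symm)
    by_contra hr
    have hr' : r.derivative ≠ 0 := fun h0 => hr (Polynomial.derivative_eq_zero.1 h0)
    exact absurd (Polynomial.natDegree_le_of_dvd hdvd hr')
      (not_le.2 (Polynomial.natDegree_derivative_lt hr))
  have hp := key p q hpq h1
  have hq := key q p hpq.symm (by rw [mul_comm, ← h1, mul_comm])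
  omega

theorem IsRationalMap.finite_isCriticalPoint {g : RSphere → RSphere} (hg : IsRationalMap g) :
    {c | IsCriticalPoint g c}.Finite := by
  have hol := hg.isHolomorphicAt
  obtain ⟨d, hd, p, q, hpq, hmax, rfl⟩ := hg
  have hW := derivative_mul_sub_ne_zero hpq (hmax ▸ hd)
  set W := p.derivative * q - p * q.derivative with hWdef
  -- The point ∞ is simply added to the roots of the Wronskian, so it needs no analysis.
  refine ((W.rootSet_finite ℂ).image ((↑) : ℂ → RSphere)).union (finite_singleton ∞) |>.subset ?_
  intro c hc
  induction c using OnePoint.rec with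
  | infty => simp
  | coe z =>
    left
    refine ⟨z, ?_, rfl⟩
    obtain ⟨k, hk, heq, hder⟩ :=
      exists_analyticAt_fractionMap_coe (isCoprime_not_eval_eq_zero hpq z)
    have h2 := (isHolomorphicAt_of_eventuallyEq (g := fractionMap p q) (c := (z : RSphere))
      (h := k) (by simpa using hk) (by simpa using heq)).2
    rw [mem_ofPred_eq, (hol z).isCriticalPoint_iff, h2.deriv_eq] at hc
    rw [Polynomial.mem_rootSet]
    exact ⟨hW, by rw [Polynomial.coe_aeval_eq_eval]; exact hder hc⟩

/-! ### Normality of families that omit an open set -/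

/-- The coordinate `1 / (z - a)` of the sphere (with the irrelevant value `0` at `a`). -/
def poleCoord (a : ℂ) (x : RSphere) : ℂ := x.elim 0 fun z => (z - a)⁻¹

/-- The inverse of the coordinate `poleCoord a`. -/
def poleCoordSymm (a : ℂ) (w : ℂ) : RSphere := OnePoint.map (fun z => z + a) (sphereInv w)

theorem continuous_poleCoordSymm (a : ℂ) : Continuous (poleCoordSymm a) := by
  refine Continuous.comp ?_ (continuous_sphereInv.comp OnePoint.continuous_coe)
  refine OnePoint.continuous_map (by fun_prop) ?_
  simpa [coclosedCompact_eq_cocompact] using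
    (Homeomorph.addRight a).isClosedEmbedding.tendsto_cocompact

theorem poleCoordSymm_poleCoord {a : ℂ} {x : RSphere} (hx : x ≠ (a : RSphere)) :
    poleCoordSymm a (poleCoord a x) = x := by
  induction x using OnePoint.rec with
  | infty => simp [poleCoord, poleCoordSymm]
  | coe z =>
    have hz : z - a ≠ 0 := fun h => hx (by rw [sub_eq_zero.1 h])
    simp [poleCoord, poleCoordSymm, sphereInv_coe_of_ne (inv_ne_zero hz)]

theorem differentiableAt_poleCoord {a : ℂ} {y : RSphere} (hy : y ≠ (a : RSphere)) :
    DifferentiableAt ℂ (fun w => poleCoord a (coordAtSymm y w)) (coordAt y y) := by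
  induction y using OnePoint.rec with
  | coe z =>
    have hz : z - a ≠ 0 := fun h => hy (by rw [sub_eq_zero.1 h])
    simp only [coordAtSymm_coe, poleCoord, OnePoint.elim_some, coordAt_coe, affineCoord_coe]
    exact (differentiableAt_id.sub_const a).inv hz
  | infty =>
    have h : (fun w => poleCoord a (coordAtSymm ∞ w)) = fun w => w / (1 - a * w) := by
      ext w
      rcases eq_or_ne w 0 with rfl | hw
      · simp [poleCoord]
      · rw [coordAtSymm_infty, sphereInv_coe_of_ne hw, poleCoord, OnePoint.elim_some,
          ← inv_div, sub_div, one_div, mul_div_cancel_right₀ _ hw]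
    rw [h]
    simp only [coordAt_infty, sphereInv_infty, affineCoord_coe]
    exact differentiableAt_id.div (by fun_prop) (by simp)

theorem differentiableAt_coordAt_coordAtSymm (c : RSphere) (w : ℂ) :
    DifferentiableAt ℂ (fun w' => coordAt (coordAtSymm c w) (coordAtSymm c w')) w := by
  induction c using OnePoint.rec with
  | coe c => simp
  | infty =>
    rcases eq_or_ne w 0 with rfl | hw
    · simp
    · simp only [coordAtSymm_infty, sphereInv_coe_of_ne hw, coordAt_coe]
      refine (differentiableAt_inv hw).congr_of_eventuallyEq ?_
      filter_upwards [isOpen_ne.mem_nhds hw] with w' hw'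
      rw [sphereInv_coe_of_ne hw', affineCoord_coe]

/-- Holomorphy of g at a point is expressed in the chart centred at that point, whereas here w moves
in the fixed chart about c; the change of chart is the extra factor. -/
theorem differentiableAt_poleCoord_comp {g : RSphere → RSphere} {a : ℂ} {c : RSphere} {w : ℂ}
    (hg : IsHolomorphicAt g (coordAtSymm c w)) (ha : g (coordAtSymm c w) ≠ (a : RSphere)) :
    DifferentiableAt ℂ (fun w => poleCoord a (g (coordAtSymm c w))) w := by
  set x := coordAtSymm c w with hx
  have h1 := differentiableAt_coordAt_coordAtSymm c w
  have h2 : DifferentiableAt ℂ (chartMap g x) (coordAt x (coordAtSymm c w)) :=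
    hg.2.differentiableAt
  have h3 : DifferentiableAt ℂ (fun w => poleCoord a (coordAtSymm (g x) w))
      (chartMap g x (coordAt x (coordAtSymm c w))) := by
    rw [← hx, chartMap_coordAt]
    exact differentiableAt_poleCoord ha
  have ht : Tendsto (coordAtSymm c) (𝓝 w) (𝓝 x) :=
    (isOpenEmbedding_coordAtSymm c).continuous.tendsto w
  have h4 := hg.eventually_eq
  have h5 : Tendsto (fun w' => coordAt x (coordAtSymm c w')) (𝓝 w) (𝓝 (coordAt x x)) :=
    (continuousAt_coordAt x).tendsto.comp ht
  refine ((h3.comp _ h2).comp w h1).congr_of_eventuallyEq ?_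
  filter_upwards [h5.eventually h4, ht.eventually (eventually_coordAtSymm_coordAt x)] with w' e1 e2
  simp only [Function.comp_apply]
  rw [← e1, e2]

/-- Cauchy's estimate on discs of radius r about the points of the smaller disc bounds the
derivative by M / r. -/
theorem lipschitzOnWith_of_differentiableOn_of_norm_le {F : ℂ → ℂ} {z : ℂ} {r : ℝ}
    {M : NNReal} (hr : 0 < r) (hd : ∀ w ∈ Metric.closedBall z (2 * r), DifferentiableAt ℂ F w)
    (hM : ∀ w ∈ Metric.closedBall z (2 * r), ‖F w‖ ≤ M) :
    LipschitzOnWith (M / r.toNNReal) F (Metric.closedBall z r) := by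
  refine (convex_closedBall z r).lipschitzOnWith_of_nnnorm_deriv_le
    (fun w hw => hd w (Metric.closedBall_subset_closedBall (by linarith) hw)) fun w hw => ?_
  have hsub : Metric.closedBall w r ⊆ Metric.closedBall z (2 * r) := by
    refine Metric.closedBall_subset_closedBall' ?_
    have := Metric.mem_closedBall.1 hw
    linarith
  rw [← NNReal.coe_le_coe, NNReal.coe_div, Real.coe_toNNReal r hr.le, coe_nnnorm]
  refine Complex.norm_deriv_le_of_forall_mem_sphere_norm_le hr ?_ fun v hv =>
    hM v (hsub (Metric.sphere_subset_closedBall hv))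
  refine DifferentiableOn.diffContOnCl ?_
  rw [closure_ball w hr.ne']
  exact fun v hv => (hd v (hsub hv)).differentiableWithinAt

theorem exists_subseq_tendstoUniformlyOn {K : Set ℂ} (hK : IsCompact K) {C M : NNReal}
    {F : ℕ → ℂ → ℂ} (hL : ∀ n, LipschitzOnWith C (F n) K) (hM : ∀ n, ∀ w ∈ K, ‖F n w‖ ≤ M) :
    ∃ (k : ℕ → ℕ) (h : ℂ → ℂ), StrictMono k ∧ (∀ w ∈ K, ‖h w‖ ≤ M) ∧
      TendstoUniformlyOn (fun n => F (k n)) h atTop K := by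
  have : CompactSpace K := isCompact_iff_compactSpace.1 hK
  let φ (n : ℕ) : BoundedContinuousFunction K ℂ :=
    BoundedContinuousFunction.mkOfCompact ⟨K.domRestrict (F n), (hL n).continuousOn.domRestrict⟩
  have hcpt : IsCompact (closure (range φ)) := by
    refine BoundedContinuousFunction.arzela_ascoli (Metric.closedBall 0 M)
      (isCompact_closedBall _ _) (range φ) ?_ ?_
    · rintro _ x ⟨n, rfl⟩
      exact mem_closedBall_zero_iff.2 (hM n x x.2)
    · refine Metric.equicontinuous_of_continuity_modulus (fun t => C * t) ?_ _ ?_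
      · have h : Continuous fun t : ℝ => (C : ℝ) * t := by fun_prop
        simpa using h.tendsto 0
      · rintro x y ⟨_, n, rfl⟩
        exact (hL n).dist_le_mul x x.2 y y.2
  obtain ⟨ψ, -, k, hk, hlim⟩ :=
    hcpt.tendsto_subseq (fun n => subset_closure (mem_range_self (f := φ) n))
  have hunif := BoundedContinuousFunction.tendsto_iff_tendstoUniformly.1 hlim
  classical
  refine ⟨k, fun w => if hw : w ∈ K then ψ ⟨w, hw⟩ else 0, hk, fun w hw => ?_, ?_⟩
  · simp only [hw, dite_true]
    refine le_of_tendsto ((hunif.tendsto_at ⟨w, hw⟩).norm) (Eventually.of_forall fun n => ?_)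
    exact hM (k n) w hw
  · intro u hu
    filter_upwards [hunif u hu] with n hn w hw
    simp only [hw, dite_true]
    exact hn ⟨w, hw⟩

/-- Sending a point a of U to ∞ turns maps that omit U into uniformly bounded holomorphic functions,
to which Cauchy's estimate and Arzelà–Ascoli apply. -/
theorem mem_fatouSet_of_notMem_closure {H : Set (RSphere → RSphere)} {U : Set RSphere}
    (hU : IsOpen U) (hne : U.Nonempty) (hH : ∀ g ∈ H, ∀ c, IsHolomorphicAt g c)
    (hHU : ∀ g ∈ H, ∀ x, x ∉ U → g x ∉ U) {c : RSphere} (hc : c ∉ closure U) :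
    c ∈ fatouSet H := by
  obtain ⟨a, ha⟩ : ∃ a : ℂ, (a : RSphere) ∈ U :=
    (OnePoint.denseRange_coe (X := ℂ)).exists_mem_open hU hne
  obtain ⟨ε, hε, hball⟩ := Metric.isOpen_iff.1 (hU.preimage OnePoint.continuous_coe) a ha
  have hbound : ∀ x ∉ U, ‖poleCoord a x‖ ≤ ε⁻¹ := by
    intro x hx
    induction x using OnePoint.rec with
    | infty => simpa [poleCoord] using hε.le
    | coe z =>
      rw [poleCoord, OnePoint.elim_some, norm_inv]
      refine inv_anti₀ hε (not_lt.1 fun h => hx (hball ?_))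
      simpa [dist_eq_norm] using h
  have hV : {w | coordAtSymm c w ∉ closure U} ∈ 𝓝 (coordAt c c) := by
    refine (isClosed_closure.isOpen_compl.preimage
      (isOpenEmbedding_coordAtSymm c).continuous).mem_nhds ?_
    simpa using hc
  obtain ⟨R, hR, hRV⟩ := Metric.nhds_basis_closedBall.mem_iff.1 hV
  obtain ⟨r, rfl⟩ : ∃ r, R = 2 * r := ⟨R / 2, by ring⟩
  have hr : 0 < r := by linarith
  have hnot : ∀ w ∈ Metric.closedBall (coordAt c c) (2 * r), coordAtSymm c w ∉ U :=
    fun w hw h => hRV hw (subset_closure h)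
  refine ⟨coordAtSymm c '' Metric.ball (coordAt c c) r,
    (isOpenEmbedding_coordAtSymm c).isOpenMap _ Metric.isOpen_ball,
    ⟨coordAt c c, Metric.mem_ball_self hr, by simp⟩, fun g hg => ?_⟩
  have hgU : ∀ n, ∀ w ∈ Metric.closedBall (coordAt c c) (2 * r), g n (coordAtSymm c w) ∉ U :=
    fun n w hw => hHU _ (hg n) _ (hnot w hw)
  have hbd : ∀ n, ∀ w ∈ Metric.closedBall (coordAt c c) (2 * r),
      ‖poleCoord a (g n (coordAtSymm c w))‖ ≤ (ε⁻¹.toNNReal : NNReal) := by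
    intro n w hw
    rw [Real.coe_toNNReal _ (inv_nonneg.2 hε.le)]
    exact hbound _ (hgU n w hw)
  have hsub : Metric.closedBall (coordAt c c) r ⊆ Metric.closedBall (coordAt c c) (2 * r) :=
    Metric.closedBall_subset_closedBall (by linarith)
  obtain ⟨k, h, hk, hh, hlim⟩ := exists_subseq_tendstoUniformlyOn
    (isCompact_closedBall (coordAt c c) r)
    (F := fun n w => poleCoord a (g n (coordAtSymm c w)))
    (fun n => lipschitzOnWith_of_differentiableOn_of_norm_le hr
      (fun w hw => differentiableAt_poleCoord_comp (hH _ (hg n) _)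
        fun h => hgU n w hw (h ▸ ha)) (hbd n))
    (fun n w hw => hbd n w (hsub hw))
  -- All coordinates and their limit lie in this compact disc, so uniform convergence of coordinates
  -- becomes uniform convergence on the sphere.
  have huc : UniformContinuousOn (poleCoordSymm a)
      (Metric.closedBall (0 : ℂ) (ε⁻¹.toNNReal : NNReal)) :=
    (isCompact_closedBall _ _).uniformContinuousOn_of_continuous
      (continuous_poleCoordSymm a).continuousOn
  refine ⟨k, fun x => poleCoordSymm a (h (coordAt c x)), hk,
    TendstoUniformlyOn.tendstoLocallyUniformlyOn fun v hv => ?_⟩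
  have hv' := huc hv
  rw [mem_map, mem_inf_principal] at hv'
  filter_upwards [hlim _ hv'] with n hn
  rintro _ ⟨w, hw, rfl⟩
  have hw' := Metric.ball_subset_closedBall hw
  have := hn w hw' ⟨by simpa using hh w hw', by simpa using hbd (k n) w (hsub hw')⟩
  have hne : g (k n) (coordAtSymm c w) ≠ (a : RSphere) := fun h => hgU (k n) w (hsub hw') (h ▸ ha)
  rw [mem_preimage, poleCoordSymm_poleCoord hne] at this
  rwa [coordAt_coordAtSymm]

/-! ### The spherical metric and area in charts -/

/-- Inversion is a chordal isometry, so the formula is the same in both charts. -/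
theorem chordalDist_coordAtSymm (y : RSphere) (w : ℂ) :
    chordalDist (coordAtSymm y w) y = 2 * ‖w - coordAt y y‖ /
      (√(1 + ‖w‖ ^ 2) * √(1 + ‖coordAt y y‖ ^ 2)) := by
  induction y using OnePoint.rec with
  | coe z => rfl
  | infty =>
    rcases eq_or_ne w 0 with rfl | hw
    · simp [chordalDist]
    · have hn : 0 < ‖w‖ := norm_pos_iff.2 hw
      have h : √(1 + ‖w⁻¹‖ ^ 2) = √(1 + ‖w‖ ^ 2) / ‖w‖ := by
        rw [norm_inv, show 1 + ‖w‖⁻¹ ^ 2 = (1 + ‖w‖ ^ 2) / ‖w‖ ^ 2 by field_simp; ring,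
          Real.sqrt_div' _ (by positivity), Real.sqrt_sq hn.le]
      rw [coordAtSymm_infty, sphereInv_coe_of_ne hw]
      change 2 / √(1 + ‖w⁻¹‖ ^ 2) = _
      rw [h]
      simp [div_div_eq_mul_div]

theorem sphericalDist_lt_of_chordalDist_lt {x y : RSphere} {t : ℝ} (ht : 0 < t) (ht1 : t ≤ 1)
    (h : chordalDist x y < t / 2) : sphericalDist x y < t := by
  have hpi := Real.pi_gt_three
  have hpi' := Real.pi_lt_four
  have h1 : Real.arcsin (chordalDist x y / 2) < t / 2 := by
    rw [Real.arcsin_lt_iff_lt_sin' ⟨by linarith, by linarith⟩]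
    -- Jordan's inequality sin x ≥ 2x/π, with 2/π ≥ 1/2, gives sin(t/2) ≥ t/4.
    have h2 := Real.mul_le_sin (x := t / 2) (by linarith) (by linarith)
    have h3 : 1 / 2 ≤ 2 / Real.pi := by
      rw [div_le_div_iff₀ (by norm_num) Real.pi_pos]
      linarith
    nlinarith
  unfold sphericalDist
  linarith

theorem chordalDist_lt_of_sphericalDist_lt {x y : RSphere} {t : ℝ} (ht : 0 < t) (ht1 : t ≤ 1)
    (h : sphericalDist x y < t) : chordalDist x y < t := by
  have hpi := Real.pi_gt_three
  have h1 : Real.arcsin (chordalDist x y / 2) < t / 2 := by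
    unfold sphericalDist at h
    linarith
  rw [Real.arcsin_lt_iff_lt_sin' ⟨by linarith, by linarith⟩] at h1
  have := Real.sin_lt (x := t / 2) (by linarith)
  linarith

theorem det_restrictScalars_toSpanSingleton (d : ℂ) :
    ((ContinuousLinearMap.toSpanSingleton ℂ d).restrictScalars ℝ).det = ‖d‖ ^ 2 := by
  simp [ContinuousLinearMap.det, LinearMap.det_restrictScalars, Algebra.norm_complex_apply,
    Complex.normSq_eq_norm_sq]

/-- The area form is invariant under w ↦ 1/w, whose Jacobian is |w|⁻⁴; the origin is a null set and
is removed for the change of variables. -/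
theorem sphericalArea_eq_lintegral_coordAtSymm (y : RSphere) {A : Set RSphere}
    (hA : MeasurableSet (coordAtSymm y ⁻¹' A)) :
    sphericalArea A =
      ∫⁻ w in coordAtSymm y ⁻¹' A, ENNReal.ofReal (4 / (1 + ‖w‖ ^ 2) ^ 2) := by
  induction y using OnePoint.rec with
  | coe z => rfl
  | infty =>
    have hnull (S : Set ℂ) : (S \ {0} : Set ℂ) =ᵐ[MeasureTheory.volume] S :=
      MeasureTheory.sdiff_null_ae_eq_self (by simp)
    have himage : ((↑) : ℂ → RSphere) ⁻¹' A \ {0} =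
        (fun w : ℂ => w⁻¹) '' (coordAtSymm ∞ ⁻¹' A \ {0}) := by
      ext z
      simp only [Set.mem_sdiff, mem_preimage, mem_singleton_iff, mem_image, coordAtSymm_infty]
      constructor
      · rintro ⟨hz, h0⟩
        exact ⟨z⁻¹, ⟨by simpa [sphereInv_coe_of_ne (inv_ne_zero h0)] using hz, inv_ne_zero h0⟩,
          inv_inv z⟩
      · rintro ⟨w, ⟨hw, h0⟩, rfl⟩
        exact ⟨by simpa [sphereInv_coe_of_ne h0] using hw, inv_ne_zero h0⟩
    unfold sphericalArea
    rw [← MeasureTheory.setLIntegral_congr (hnull _), himage,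
      MeasureTheory.lintegral_image_eq_lintegral_abs_det_fderiv_mul MeasureTheory.volume
        (hA.diff (measurableSet_singleton 0))
        (f' := fun w => (ContinuousLinearMap.toSpanSingleton ℂ (-(w ^ 2)⁻¹)).restrictScalars ℝ)
        (fun w hw => ((hasDerivAt_inv hw.2).hasFDerivAt.restrictScalars ℝ).hasFDerivWithinAt)
        inv_injective.injOn,
      ← MeasureTheory.setLIntegral_congr (hnull (coordAtSymm ∞ ⁻¹' A))]
    refine MeasureTheory.setLIntegral_congr_fun (hA.diff (measurableSet_singleton 0)) fun w hw => ?_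
    have hn : ‖w‖ ≠ 0 := norm_ne_zero_iff.2 hw.2
    rw [det_restrictScalars_toSpanSingleton, ← ENNReal.ofReal_mul (abs_nonneg _)]
    congr 1
    rw [abs_of_nonneg (by positivity), norm_neg, norm_inv, norm_pow, norm_inv]
    field_simp
    ring

/-! ### Lower density of planar sets -/

/-- `A` fills at least the proportion `β` of each small disc about `z`. -/
def HasLowerDensityAt (β : ENNReal) (A : Set ℂ) (z : ℂ) : Prop :=
  ∀ᶠ r in 𝓝[>] (0 : ℝ), β * MeasureTheory.volume (Metric.ball z r) ≤
    MeasureTheory.volume (Metric.ball z r ∩ A)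

theorem volume_ball_div (z : ℂ) {r k : ℝ} (hk : 0 < k) :
    MeasureTheory.volume (Metric.ball z (r / k)) =
      ENNReal.ofReal (1 / k ^ 2) * MeasureTheory.volume (Metric.ball z r) := by
  rw [Complex.volume_ball, Complex.volume_ball, ← mul_assoc, ENNReal.ofReal_div_of_pos hk,
    ENNReal.ofReal_div_of_pos (by positivity), ENNReal.ofReal_pow hk.le, ENNReal.ofReal_one,
    div_eq_mul_inv, mul_pow, one_div, ENNReal.inv_pow, mul_comm (ENNReal.ofReal r ^ 2)]

/-- Near w₀ the spherical ball of radius t = s/(2D) lies between the discs of radii s/16 and s, and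
the area density lies between 1/D² and 16/D². The loss is 16 · 16² = 4096. -/
theorem hasLowerDensityAt_of_sphericalArea {U : Set RSphere} (hU : IsOpen U) {y : RSphere} {α : ℝ}
    (hα : 0 ≤ α)
    (h : ∀ r : ℝ, 0 < r → r ≤ 1 → ENNReal.ofReal α * sphericalArea (sphericalBall y r) ≤
      sphericalArea (U ∩ sphericalBall y r)) :
    HasLowerDensityAt (ENNReal.ofReal (α / 4096)) (coordAtSymm y ⁻¹' U) (coordAt y y) := by
  set w₀ := coordAt y y with hw₀
  set D : ℝ := 1 + ‖w₀‖ ^ 2 with hD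
  have hD1 : 1 ≤ D := by nlinarith [sq_nonneg ‖w₀‖]
  have hsD : √D * √D = D := Real.mul_self_sqrt (by linarith)
  have hsD1 : 1 ≤ √D := Real.one_le_sqrt.2 hD1
  have hcont : Continuous fun w : ℂ => 1 + ‖w‖ ^ 2 := by fun_prop
  have hnear : {w : ℂ | D / 2 < 1 + ‖w‖ ^ 2 ∧ 1 + ‖w‖ ^ 2 < 2 * D} ∈ 𝓝 w₀ :=
    ((isOpen_lt continuous_const hcont).inter (isOpen_lt hcont continuous_const)).mem_nhds
      ⟨by change D / 2 < D; linarith, by change D < 2 * D; linarith⟩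
  obtain ⟨η, hη, hball⟩ := Metric.mem_nhds_iff.1 hnear
  have hev : ∀ᶠ s in 𝓝[>] (0 : ℝ), 0 < s ∧ s < min η (√D) :=
    Ioo_mem_nhdsGT (lt_min hη (by linarith))
  filter_upwards [hev] with s hs
  have hsη : s < η := hs.2.trans_le (min_le_left _ _)
  have hs1 : s < √D := hs.2.trans_le (min_le_right _ _)
  set t := s / (2 * D) with ht
  have hts : 2 * t * D = s := by rw [ht]; field_simp
  have ht0 : 0 < t := div_pos hs.1 (by linarith)
  have htD : t * √D ≤ 1 := by nlinarith
  have ht1 : t ≤ 1 := by nlinarith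
  set B := coordAtSymm y ⁻¹' sphericalBall y t with hB
  have hBmeas : MeasurableSet B := by
    have h1 : B = {w : ℂ | 2 * Real.arcsin (2 * ‖w - w₀‖ / (√(1 + ‖w‖ ^ 2) * √D) / 2) < t} := by
      ext w
      change sphericalDist _ _ < t ↔ _
      rw [sphericalDist, chordalDist_coordAtSymm]
      rfl
    rw [h1]
    refine measurableSet_lt ?_ measurable_const
    exact (Real.measurable_arcsin.comp (by fun_prop)).const_mul 2
  have hsub1 : B ⊆ Metric.ball w₀ s := by
    intro w hw
    have h1 := chordalDist_lt_of_sphericalDist_lt ht0 ht1 hw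
    have hpos : 0 < √(1 + ‖w‖ ^ 2) := Real.sqrt_pos.2 (by positivity)
    rw [chordalDist_coordAtSymm, div_lt_iff₀ (mul_pos hpos (by linarith))] at h1
    have h2 : √(1 + ‖w‖ ^ 2) ≤ 1 + ‖w‖ :=
      (Real.sqrt_le_left (by positivity)).2 (by nlinarith [norm_nonneg w])
    have h3 : ‖w‖ ≤ ‖w₀‖ + ‖w - w₀‖ := by
      have := norm_add_le w₀ (w - w₀)
      rwa [add_sub_cancel] at this
    have h4 : ‖w₀‖ ≤ √D := Real.le_sqrt_of_sq_le (by linarith)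
    -- The point w is not yet known to be near w₀, so this bound must hold for all w; the term ‖w -
    -- w₀‖ is absorbed at the end because t√D ≤ 1.
    have h5 : √(1 + ‖w‖ ^ 2) ≤ 2 * √D + ‖w - w₀‖ := by linarith
    have h6 := mul_le_mul_of_nonneg_left h5 (mul_pos ht0 (by linarith : 0 < √D)).le
    have h7 := mul_le_mul_of_nonneg_right htD (norm_nonneg (w - w₀))
    rw [Metric.mem_ball, dist_eq_norm]
    have h8 : t * √D * (2 * √D) = s := by rw [← hts]; linear_combination 2 * t * hsD
    nlinarith
  have hsub2 : Metric.ball w₀ (s / 16) ⊆ B := by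
    intro w hw
    have hw' := hball (Metric.ball_subset_ball (by linarith [hs.1]) hw)
    refine sphericalDist_lt_of_chordalDist_lt ht0 ht1 ?_
    have hpos : 0 < √(1 + ‖w‖ ^ 2) := Real.sqrt_pos.2 (by positivity)
    rw [chordalDist_coordAtSymm, div_lt_iff₀ (mul_pos hpos (by linarith))]
    have h1 : √D / 2 ≤ √(1 + ‖w‖ ^ 2) :=
      Real.le_sqrt_of_sq_le (by nlinarith [hw'.1, Real.sq_sqrt (by linarith : 0 ≤ D)])
    have h2 := mul_le_mul_of_nonneg_right h1 (by linarith : 0 ≤ √D)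
    rw [Metric.mem_ball, dist_eq_norm] at hw
    nlinarith
  have hUmeas : MeasurableSet (coordAtSymm y ⁻¹' U) :=
    (hU.preimage (isOpenEmbedding_coordAtSymm y).continuous).measurableSet
  have hlow : ENNReal.ofReal (1 / D ^ 2) * MeasureTheory.volume (Metric.ball w₀ (s / 16)) ≤
      sphericalArea (sphericalBall y t) := by
    rw [sphericalArea_eq_lintegral_coordAtSymm y hBmeas, ← MeasureTheory.setLIntegral_const]
    refine (MeasureTheory.setLIntegral_mono' Metric.isOpen_ball.measurableSet fun w hw => ?_).trans
      (MeasureTheory.lintegral_mono_set hsub2)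
    have hw' := hball (Metric.ball_subset_ball (by linarith [hs.1]) hw)
    refine ENNReal.ofReal_le_ofReal ?_
    rw [div_le_div_iff₀ (by positivity) (by positivity)]
    have := pow_le_pow_left₀ (by positivity) hw'.2.le 2
    nlinarith
  have hup : sphericalArea (U ∩ sphericalBall y t) ≤ ENNReal.ofReal (16 / D ^ 2) *
      MeasureTheory.volume (Metric.ball w₀ s ∩ coordAtSymm y ⁻¹' U) := by
    rw [sphericalArea_eq_lintegral_coordAtSymm y
      (show MeasurableSet (coordAtSymm y ⁻¹' (U ∩ sphericalBall y t)) from hUmeas.inter hBmeas),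
      ← MeasureTheory.setLIntegral_const]
    refine (MeasureTheory.setLIntegral_mono measurable_const fun w hw => ?_).trans
      (MeasureTheory.lintegral_mono_set fun w hw => ⟨hsub1 hw.2, hw.1⟩)
    have hw' := hball (Metric.ball_subset_ball hsη.le (hsub1 hw.2))
    refine ENNReal.ofReal_le_ofReal ?_
    rw [div_le_div_iff₀ (by positivity) (by positivity)]
    have := pow_le_pow_left₀ (by positivity) hw'.1.le 2
    nlinarith
  have hmain : ENNReal.ofReal α * (ENNReal.ofReal (1 / D ^ 2) *
      MeasureTheory.volume (Metric.ball w₀ (s / 16))) ≤ ENNReal.ofReal (16 / D ^ 2) *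
      MeasureTheory.volume (Metric.ball w₀ s ∩ coordAtSymm y ⁻¹' U) :=
    (mul_le_mul_right hlow _).trans ((h t ht0 ht1).trans hup)
  rw [volume_ball_div w₀ (by norm_num : (0 : ℝ) < 16), ← mul_assoc, ← mul_assoc,
    ← ENNReal.ofReal_mul hα, ← ENNReal.ofReal_mul (by positivity)] at hmain
  have hc : 0 < 16 / D ^ 2 := by positivity
  have hc' : α * (1 / D ^ 2) * (1 / 16 ^ 2) = 16 / D ^ 2 * (α / 4096) := by ring
  rw [hc', ENNReal.ofReal_mul hc.le, mul_assoc] at hmain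
  exact (ENNReal.mul_le_mul_iff_right (ENNReal.ofReal_pos.2 hc).ne' ENNReal.ofReal_ne_top).1 hmain

/-- The local inverse is 2/|d|-Lipschitz and multiplies area by at least |d|⁻²/2. It sends the disc
of radius s = r|d|/2 into that of radius r, whose area is 4/|d|² times as large; hence the factor
(|d|⁻²/2)(|d|²/4) = 1/8, independent of d. -/
theorem HasLowerDensityAt.preimage {β : ENNReal} {A : Set ℂ} {h : ℂ → ℂ} {d z : ℂ}
    (hh : HasStrictDerivAt h d z) (hd : d ≠ 0) (hA : HasLowerDensityAt β A (h z)) :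
    HasLowerDensityAt (ENNReal.ofReal (1 / 8) * β) (h ⁻¹' A) z := by
  have hdn : 0 < ‖d‖ := norm_pos_iff.2 hd
  set ψ := hh.localInverse h d z hd with hψdef
  have hψ : HasStrictDerivAt ψ d⁻¹ (h z) := hh.to_localInverse hd
  have hψz : ψ (h z) = z := HasStrictFDerivAt.localInverse_apply_image _
  have hright : ∀ᶠ w in 𝓝 (h z), h (ψ w) = w :=
    HasStrictFDerivAt.eventually_right_inverse (hh.hasStrictFDerivAt_equiv hd)
  have hF := hψ.hasStrictFDerivAt.restrictScalars ℝ
  set F := (ContinuousLinearMap.toSpanSingleton ℂ d⁻¹).restrictScalars ℝ with hFdef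
  have hdet : F.det = ‖d‖⁻¹ ^ 2 := by
    rw [hFdef, det_restrictScalars_toSpanSingleton, norm_inv]
  have hm : ((‖d‖⁻¹ ^ 2 / 2).toNNReal : ENNReal) < ENNReal.ofReal |F.det| := by
    have hp : 0 < ‖d‖⁻¹ ^ 2 := by positivity
    rw [hdet, abs_of_pos hp]
    exact (ENNReal.ofReal_lt_ofReal_iff hp).2 (by linarith)
  obtain ⟨δ, hδ, hδ0⟩ := ((MeasureTheory.mul_le_addHaar_image_of_lt_det
    (MeasureTheory.volume : MeasureTheory.Measure ℂ) F hm).and self_mem_nhdsWithin).exists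
  obtain ⟨S, hS, hSF⟩ := hF.approximates_deriv_on_nhds (Or.inr hδ0)
  have hK : ‖F‖₊ < (2 * ‖d‖⁻¹).toNNReal := by
    rw [← NNReal.coe_lt_coe, Real.coe_toNNReal _ (by positivity), coe_nnnorm]
    refine lt_of_le_of_lt (b := ‖d‖⁻¹) ?_ (by nlinarith [inv_pos.2 hdn])
    refine F.opNorm_le_bound (by positivity) fun x => ?_
    simp [hFdef, mul_comm]
  obtain ⟨T, hT, hTL⟩ := hF.exists_lipschitzOnWith_of_nnnorm_lt _ hK
  obtain ⟨η, hη, hηsub⟩ := Metric.mem_nhds_iff.1 (inter_mem (inter_mem hS hT) hright)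
  have htend : Tendsto (fun r : ℝ => r / (2 / ‖d‖)) (𝓝[>] 0) (𝓝[>] 0) := by
    refine tendsto_nhdsWithin_iff.2 ⟨?_, ?_⟩
    · have : Continuous fun r : ℝ => r / (2 / ‖d‖) := by fun_prop
      simpa using (this.tendsto 0).mono_left nhdsWithin_le_nhds
    · filter_upwards [self_mem_nhdsWithin] with r hr
      exact div_pos (mem_Ioi.1 hr) (div_pos two_pos hdn)
  filter_upwards [htend.eventually hA, htend.eventually (Ioo_mem_nhdsGT hη)] with r hr hr'
  set s := r / (2 / ‖d‖) with hs
  have hrs : r = 2 * ‖d‖⁻¹ * s := by rw [hs]; field_simp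
  have hsub : Metric.ball (h z) s ⊆ (S ∩ T) ∩ {w | h (ψ w) = w} :=
    (Metric.ball_subset_ball hr'.2.le).trans hηsub
  have hcz : h z ∈ Metric.ball (h z) s := Metric.mem_ball_self hr'.1
  have himg : ψ '' (Metric.ball (h z) s ∩ A) ⊆ Metric.ball z r ∩ h ⁻¹' A := by
    rintro _ ⟨w, ⟨hw, hwA⟩, rfl⟩
    refine ⟨?_, ?_⟩
    · have h1 := hTL.dist_le_mul w (hsub hw).1.2 (h z) (hsub hcz).1.2
      rw [hψz, Real.coe_toNNReal _ (by positivity)] at h1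
      rw [Metric.mem_ball, hrs]
      exact h1.trans_lt (mul_lt_mul_of_pos_left hw (by positivity))
    · rw [mem_preimage, (hsub hw).2]
      exact hwA
  have happ : ApproximatesLinearOn ψ F (Metric.ball (h z) s ∩ A) δ :=
    hSF.mono_set fun w hw => (hsub hw.1).1.1
  have h1 : MeasureTheory.volume (Metric.ball (h z) s) =
      ENNReal.ofReal (1 / (2 / ‖d‖) ^ 2) * MeasureTheory.volume (Metric.ball z r) := by
    rw [hs, volume_ball_div _ (by positivity), Complex.volume_ball, Complex.volume_ball]
  have h2 := (mul_le_mul_right hr _).trans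
    ((hδ _ ψ happ).trans (MeasureTheory.measure_mono himg))
  refine le_trans (le_of_eq ?_) h2
  have h3 : ENNReal.ofReal (1 / 8) =
      ENNReal.ofReal (‖d‖⁻¹ ^ 2 / 2) * ENNReal.ofReal (1 / (2 / ‖d‖) ^ 2) := by
    rw [← ENNReal.ofReal_mul (by positivity)]
    congr 1
    field_simp
    norm_num
  rw [h1, h3]
  change _ = ENNReal.ofReal (‖d‖⁻¹ ^ 2 / 2) * _
  ring

/-- Finitely many density conditions share a radius, and in that disc the areas of disjoint pieces
add up to at most the area of the disc. -/
theorem card_mul_le_one_of_hasLowerDensityAt {ι : Type*} (t : Finset ι) {A : ι → Set ℂ}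
    {β : ENNReal} {z : ℂ} (hmeas : ∀ i ∈ t, MeasurableSet (A i))
    (hdisj : (t : Set ι).PairwiseDisjoint A) (hA : ∀ i ∈ t, HasLowerDensityAt β (A i) z) :
    t.card * β ≤ 1 := by
  have hev : ∀ᶠ r in 𝓝[>] (0 : ℝ), ∀ i ∈ t, β * MeasureTheory.volume (Metric.ball z r) ≤
      MeasureTheory.volume (Metric.ball z r ∩ A i) := (Filter.eventually_all_finset t).2 hA
  obtain ⟨r, hr, hr0⟩ := (hev.and self_mem_nhdsWithin).exists
  have hsum : ∑ i ∈ t, MeasureTheory.volume (Metric.ball z r ∩ A i) ≤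
      MeasureTheory.volume (Metric.ball z r) := by
    rw [← MeasureTheory.measure_biUnion_finset
      (fun i hi j hj hij => (hdisj hi hj hij).mono inter_subset_right inter_subset_right)
      fun i hi => Metric.isOpen_ball.measurableSet.inter (hmeas i hi)]
    exact MeasureTheory.measure_mono (iUnion₂_subset fun i _ => inter_subset_left)
  have h1 : t.card * β * MeasureTheory.volume (Metric.ball z r) ≤
      1 * MeasureTheory.volume (Metric.ball z r) := by
    refine le_trans (le_of_eq ?_) ((Finset.sum_le_sum hr).trans (hsum.trans_eq (one_mul _).symm))
    rw [Finset.sum_const, nsmul_eq_mul, mul_assoc]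
  exact (ENNReal.mul_le_mul_iff_left (Metric.measure_ball_pos _ _ hr0).ne'
    MeasureTheory.measure_ball_lt_top.ne).1 h1

/-! ### The semigroup and the fibre maps -/

theorem generator_mem_genSemigroup {u : ℕ} (f : Fin u → RSphere → RSphere) (i : Fin u) :
    f i ∈ genSemigroup f :=
  Subsemigroup.subset_closure (M := Function.End RSphere) ⟨i, rfl⟩

theorem comp_mem_genSemigroup {u : ℕ} {f : Fin u → RSphere → RSphere} {g h : RSphere → RSphere}
    (hg : g ∈ genSemigroup f) (hh : h ∈ genSemigroup f) : g ∘ h ∈ genSemigroup f :=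
  (Subsemigroup.closure {h : Function.End RSphere | ∃ j, h = f j}).mul_mem' hg hh

theorem genSemigroup_induction {u : ℕ} {f : Fin u → RSphere → RSphere}
    {p : (RSphere → RSphere) → Prop} (hgen : ∀ i, p (f i)) (hcomp : ∀ g h, p g → p h → p (g ∘ h))
    {g : RSphere → RSphere} (hg : g ∈ genSemigroup f) : p g := by
  refine Subsemigroup.closure_induction (M := Function.End RSphere) (p := fun h _ => p h) ?_ ?_ hg
  · rintro _ ⟨j, rfl⟩
    exact hgen j
  · exact fun g h _ _ hg hh => hcomp g h hg hh

theorem isHolomorphicAt_of_mem_genSemigroup {u : ℕ} {f : Fin u → RSphere → RSphere}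
    (hf : ∀ i, IsRationalMap (f i)) {g : RSphere → RSphere} (hg : g ∈ genSemigroup f) :
    ∀ c, IsHolomorphicAt g c :=
  genSemigroup_induction (p := fun g => ∀ c, IsHolomorphicAt g c)
    (fun i => (hf i).isHolomorphicAt) (fun _ _ hg hh c => (hg _).comp (hh c)) hg

theorem notMem_of_mem_genSemigroup {u : ℕ} {f : Fin u → RSphere → RSphere} {U : Set RSphere}
    (hU : (⋃ i, f i ⁻¹' U) ⊆ U) {g : RSphere → RSphere} (hg : g ∈ genSemigroup f) :
    ∀ x ∉ U, g x ∉ U :=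
  genSemigroup_induction (p := fun g => ∀ x ∉ U, g x ∉ U)
    (fun i _ hx h => hx (hU (mem_iUnion.2 ⟨i, h⟩))) (fun _ _ hg hh x hx => hg _ (hh x hx)) hg

theorem juliaSet_subset_closure {u : ℕ} {f : Fin u → RSphere → RSphere}
    (hf : ∀ i, IsRationalMap (f i)) {U : Set RSphere} (hU : IsOpen U) (hne : U.Nonempty)
    (hfU : (⋃ i, f i ⁻¹' U) ⊆ U) : juliaSet (genSemigroup f) ⊆ closure U := by
  intro z hz
  by_contra hzU
  exact hz (mem_fatouSet_of_notMem_closure hU hne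
    (fun g hg => isHolomorphicAt_of_mem_genSemigroup hf hg)
    (fun g hg => notMem_of_mem_genSemigroup hfU hg) hzU)

theorem skewProduct_iterate_fst {u : ℕ} (f : Fin u → RSphere → RSphere)
    (ξ : (ℕ → Fin u) × RSphere) (n : ℕ) :
    ((skewProduct f)^[n] ξ).1 = fun k => ξ.1 (k + n) := by
  induction n with
  | zero => rfl
  | succ n ih =>
    rw [Function.iterate_succ_apply', skewProduct, ih]
    ext k
    simp [add_assoc, add_comm 1 n]

theorem fibreMap_zero {u : ℕ} (f : Fin u → RSphere → RSphere) (ω : ℕ → Fin u) :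
    fibreMap f ω 0 = id := rfl

theorem fibreMap_succ {u : ℕ} (f : Fin u → RSphere → RSphere) (ω : ℕ → Fin u) (n : ℕ) :
    fibreMap f ω (n + 1) = f (ω n) ∘ fibreMap f ω n := by
  ext z
  simp [fibreMap, Function.iterate_succ_apply', skewProduct, skewProduct_iterate_fst]

theorem fibreMap_succ' {u : ℕ} (f : Fin u → RSphere → RSphere) (ω : ℕ → Fin u) (n : ℕ) :
    fibreMap f ω (n + 1) = fibreMap f (fun k => ω (k + 1)) n ∘ f (ω 0) := rfl

theorem fibreMap_succ_mem_genSemigroup {u : ℕ} (f : Fin u → RSphere → RSphere) (ω : ℕ → Fin u)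
    (n : ℕ) : fibreMap f ω (n + 1) ∈ genSemigroup f := by
  induction n with
  | zero => exact generator_mem_genSemigroup f (ω 0)
  | succ n ih =>
    rw [fibreMap_succ]
    exact comp_mem_genSemigroup (generator_mem_genSemigroup f _) ih

theorem isHolomorphicAt_fibreMap {u : ℕ} {f : Fin u → RSphere → RSphere}
    (hf : ∀ i, IsRationalMap (f i)) (ω : ℕ → Fin u) (n : ℕ) (c : RSphere) :
    IsHolomorphicAt (fibreMap f ω n) c := by
  cases n with
  | zero => exact (isHolomorphicAt_id c).1
  | succ n =>
    exact isHolomorphicAt_of_mem_genSemigroup hf (fibreMap_succ_mem_genSemigroup f ω n) c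

theorem mem_of_fibreMap_mem {u : ℕ} {f : Fin u → RSphere → RSphere} {U : Set RSphere}
    (hU : (⋃ i, f i ⁻¹' U) ⊆ U) {ω : ℕ → Fin u} {n : ℕ} {x : RSphere}
    (hx : fibreMap f ω n x ∈ U) : x ∈ U := by
  cases n with
  | zero => exact hx
  | succ n =>
    by_contra h
    exact notMem_of_mem_genSemigroup hU (fibreMap_succ_mem_genSemigroup f ω n) x h hx

/-- Strip the common first letters. At the first disagreement, backward invariance of U places the
two sets in f_i⁻¹(U) and f_j⁻¹(U) with i ≠ j. -/
theorem disjoint_preimage_fibreMap {u : ℕ} {f : Fin u → RSphere → RSphere} {U : Set RSphere}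
    (hU : (⋃ i, f i ⁻¹' U) ⊆ U) (hdisj : ∀ i j, i ≠ j → f i ⁻¹' U ∩ f j ⁻¹' U = ∅)
    {n : ℕ} {τ τ' : ℕ → Fin u} (hne : ∃ k < n, τ k ≠ τ' k) :
    Disjoint (fibreMap f τ n ⁻¹' U) (fibreMap f τ' n ⁻¹' U) := by
  rw [Set.disjoint_left]
  intro x hx hx'
  induction n generalizing τ τ' x with
  | zero =>
    obtain ⟨k, hk, -⟩ := hne
    exact absurd hk (Nat.not_lt_zero k)
  | succ n ih =>
    rw [fibreMap_succ'] at hx hx'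
    by_cases h0 : τ 0 = τ' 0
    · obtain ⟨k, hk, hkne⟩ := hne
      obtain ⟨m, rfl⟩ : ∃ m, k = m + 1 := Nat.exists_eq_succ_of_ne_zero fun h => hkne (h ▸ h0)
      refine ih (τ := fun k => τ (k + 1)) (τ' := fun k => τ' (k + 1)) ⟨m, by omega, hkne⟩
        (x := f (τ 0) x) hx ?_
      rw [h0]
      exact hx'
    · have h1 : x ∈ f (τ 0) ⁻¹' U ∩ f (τ' 0) ⁻¹' U :=
        ⟨mem_of_fibreMap_mem hU hx, mem_of_fibreMap_mem hU hx'⟩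
      rw [hdisj _ _ h0] at h1
      exact h1

/-! ### Julia sets -/

theorem isOpen_fatouSet (H : Set (RSphere → RSphere)) : IsOpen (fatouSet H) := by
  rw [isOpen_iff_mem_nhds]
  rintro z ⟨W, hW, hz, hn⟩
  exact mem_of_superset (hW.mem_nhds hz) fun x hx => ⟨W, hW, hx, hn⟩

theorem juliaSet_mono {H H' : Set (RSphere → RSphere)} (h : H ⊆ H') : juliaSet H ⊆ juliaSet H' := by
  refine compl_subset_compl.2 ?_
  rintro z ⟨W, hW, hz, hn⟩
  exact ⟨W, hW, hz, fun g hg => hn g fun n => h (hg n)⟩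

/-- A sequence in H' either equals Φ infinitely often, giving a constant subsequence, or is
eventually of the form h ∘ Φ, and convergence pulls back along Φ. The alternative g = Φ covers the
word of length one, whose shift is empty. -/
theorem mem_fatouSet_of_subset_comp {H H' : Set (RSphere → RSphere)} {Φ : RSphere → RSphere}
    (hΦ : Continuous Φ) (hH : ∀ g ∈ H', g = Φ ∨ ∃ h ∈ H, g = h ∘ Φ) {z : RSphere}
    (hz : Φ z ∈ fatouSet H) : z ∈ fatouSet H' := by
  obtain ⟨W, hW, hzW, hn⟩ := hz
  refine ⟨Φ ⁻¹' W, hW.preimage hΦ, hzW, fun g hg => ?_⟩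
  by_cases hfreq : ∃ᶠ n in atTop, g n = Φ
  · obtain ⟨k, hk, hgk⟩ := extraction_of_frequently_atTop hfreq
    refine ⟨k, Φ, hk, TendstoUniformlyOn.tendstoLocallyUniformlyOn fun v hv => ?_⟩
    refine Eventually.of_forall fun n x _ => ?_
    rw [hgk n]
    exact refl_mem_uniformity hv
  · obtain ⟨N, hN⟩ := eventually_atTop.1 (not_frequently.1 hfreq)
    have h1 (n : ℕ) : ∃ h ∈ H, g (n + N) = h ∘ Φ :=
      (hH _ (hg (n + N))).resolve_left (hN _ (Nat.le_add_left N n))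
    choose h hhH hgh using h1
    obtain ⟨k, l, hk, hl⟩ := hn h hhH
    refine ⟨fun n => k n + N, l ∘ Φ, fun a b hab => Nat.add_lt_add_right (hk hab) N, ?_⟩
    have h2 := hl.comp Φ (mapsTo_preimage Φ W) hΦ.continuousOn
    simpa only [hgh] using h2

theorem mem_fibreJuliaSet_shift {u : ℕ} {f : Fin u → RSphere → RSphere}
    (hf : ∀ i, IsRationalMap (f i)) {ω : ℕ → Fin u} {z : RSphere} (hz : z ∈ fibreJuliaSet f ω) :
    f (ω 0) z ∈ fibreJuliaSet f fun k => ω (k + 1) := by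
  intro h
  refine hz (mem_fatouSet_of_subset_comp (hf (ω 0)).continuous ?_ h)
  rintro _ ⟨n, hn, rfl⟩
  obtain ⟨m, rfl⟩ : ∃ m, n = m + 1 := Nat.exists_eq_succ_of_ne_zero (by omega)
  rcases Nat.eq_zero_or_pos m with rfl | hm
  · exact Or.inl rfl
  · exact Or.inr ⟨_, ⟨m, hm, rfl⟩, fibreMap_succ' f ω m⟩

theorem fibreJuliaSet_subset_juliaSet {u : ℕ} (f : Fin u → RSphere → RSphere) (ω : ℕ → Fin u) :
    fibreJuliaSet f ω ⊆ juliaSet (genSemigroup f) := by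
  refine juliaSet_mono ?_
  rintro _ ⟨n, hn, rfl⟩
  obtain ⟨m, rfl⟩ : ∃ m, n = m + 1 := Nat.exists_eq_succ_of_ne_zero (by omega)
  exact fibreMap_succ_mem_genSemigroup f ω m

theorem continuous_skewProduct {u : ℕ} {f : Fin u → RSphere → RSphere}
    (hf : ∀ i, Continuous (f i)) : Continuous (skewProduct f) := by
  refine Continuous.prodMk (by fun_prop) ?_
  have h : Continuous fun p : Fin u × RSphere => f p.1 p.2 :=
    continuous_prod_of_discrete_left.2 hf
  have h0 : Continuous fun ξ : (ℕ → Fin u) × RSphere => ξ.1 0 :=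
    (continuous_apply 0).comp continuous_fst
  exact h.comp (h0.prodMk continuous_snd)

theorem fibreMap_mem_juliaSet {u : ℕ} {f : Fin u → RSphere → RSphere}
    (hf : ∀ i, IsRationalMap (f i)) (n : ℕ) {ω : ℕ → Fin u} {z : RSphere}
    (hz : z ∈ fibreJuliaSet f ω) : fibreMap f ω n z ∈ juliaSet (genSemigroup f) := by
  induction n generalizing ω z with
  | zero => exact fibreJuliaSet_subset_juliaSet f ω hz
  | succ n ih => exact ih (mem_fibreJuliaSet_shift hf hz)

/-- The condition is closed in ξ, as J(G) is closed and the skew product continuous, so it passes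
from the fibre Julia sets to their closure. -/
theorem fibreMap_mem_juliaSet_of_mem_skewJuliaSet {u : ℕ} {f : Fin u → RSphere → RSphere}
    (hf : ∀ i, IsRationalMap (f i)) {ξ : (ℕ → Fin u) × RSphere} (hξ : ξ ∈ skewJuliaSet f) (n : ℕ) :
    fibreMap f ξ.1 n ξ.2 ∈ juliaSet (genSemigroup f) := by
  have hclosed : IsClosed {ξ | ((skewProduct f)^[n] ξ).2 ∈ juliaSet (genSemigroup f)} :=
    (isOpen_fatouSet _).isClosed_compl.preimage
      (continuous_snd.comp ((continuous_skewProduct fun i => (hf i).continuous).iterate n))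
  have hsub : {ξ : (ℕ → Fin u) × RSphere | ξ.2 ∈ fibreJuliaSet f ξ.1} ⊆
      {ξ | ((skewProduct f)^[n] ξ).2 ∈ juliaSet (genSemigroup f)} :=
    fun _ hz => fibreMap_mem_juliaSet hf n hz
  exact closure_minimal hsub hclosed hξ

/-! ### Orbits of critical values -/

theorem mapsTo_postcriticalSet {u : ℕ} {f : Fin u → RSphere → RSphere}
    (hf : ∀ i, IsRationalMap (f i)) (i : Fin u) :
    MapsTo (f i) (postcriticalSet f) (postcriticalSet f) := by
  refine MapsTo.closure ?_ (hf i).continuous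
  rintro _ ⟨g, hg, j, c, hc, rfl⟩
  refine ⟨f i ∘ g, Or.inl ?_, j, c, hc, rfl⟩
  rcases hg with hg | rfl
  · exact comp_mem_genSemigroup (generator_mem_genSemigroup f i) hg
  · exact generator_mem_genSemigroup f i

/-- By the chain rule a zero derivative would need an orbit point critical for the next generator.
Its image lies in J(G), so that point would be in Crit_*, while forward invariance keeps it in
PCV(G). -/
theorem deriv_chartMap_fibreMap_ne_zero {u : ℕ} {f : Fin u → RSphere → RSphere}
    (hf : ∀ i, IsRationalMap (f i)) (hcrit : critStar f ∩ postcriticalSet f = ∅) {v : RSphere}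
    (hv : v ∈ postcriticalSet f) {τ : ℕ → Fin u}
    (hτ : ∀ n, fibreMap f τ n v ∈ juliaSet (genSemigroup f)) (n : ℕ) :
    fibreMap f τ n v ∈ postcriticalSet f ∧
      deriv (chartMap (fibreMap f τ n) v) (coordAt v v) ≠ 0 := by
  induction n with
  | zero =>
    refine ⟨hv, ?_⟩
    rw [fibreMap_zero, (isHolomorphicAt_id v).2]
    exact one_ne_zero
  | succ n ih =>
    have hJ := hτ (n + 1)
    rw [fibreMap_succ] at hJ ⊢
    have hol := (hf (τ n)).isHolomorphicAt (fibreMap f τ n v)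
    refine ⟨mapsTo_postcriticalSet hf _ ih.1, ?_⟩
    rw [deriv_chartMap_comp hol (isHolomorphicAt_fibreMap hf τ n v)]
    refine mul_ne_zero (fun h0 => ?_) ih.2
    have : fibreMap f τ n v ∈ critStar f ∩ postcriticalSet f :=
      ⟨⟨τ n, hol.isCriticalPoint_iff.2 h0, hJ⟩, ih.1⟩
    rw [hcrit] at this
    exact this

theorem exists_forall_exists_lt_ne {α : Type*} (t : Finset (ℕ → α)) :
    ∃ n, ∀ τ ∈ t, ∀ τ' ∈ t, τ ≠ τ' → ∃ k < n, τ k ≠ τ' k := by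
  have h : ∀ p ∈ t ×ˢ t, ∀ᶠ n : ℕ in atTop, p.1 ≠ p.2 → ∃ k < n, p.1 k ≠ p.2 k := by
    intro p _
    by_cases hp : p.1 = p.2
    · exact Eventually.of_forall fun n hn => absurd hp hn
    · obtain ⟨k, hk⟩ := Function.ne_iff.1 hp
      filter_upwards [eventually_gt_atTop k] with n hn _
      exact ⟨k, hn, hk⟩
  obtain ⟨n, hn⟩ := ((Filter.eventually_all_finset (t ×ˢ t)).2 h).exists
  exact ⟨n, fun τ hτ τ' hτ' => hn (τ, τ') (Finset.mk_mem_product hτ hτ')⟩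

theorem finite_setOf_forall_fibreMap_mem_juliaSet {u : ℕ} {f : Fin u → RSphere → RSphere}
    (hf : ∀ i, IsRationalMap (f i)) (hcrit : critStar f ∩ postcriticalSet f = ∅)
    (hNOSC : NiceOpenSetCondition f) {v : RSphere} (hv : v ∈ postcriticalSet f) :
    {τ : ℕ → Fin u | ∀ n, fibreMap f τ n v ∈ juliaSet (genSemigroup f)}.Finite := by
  obtain ⟨U, hU, hne, hfU, hdisj, α, hα0, hα1, hα⟩ := hNOSC
  set β : ENNReal := ENNReal.ofReal (1 / 8) * ENNReal.ofReal (α / 4096) with hβ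
  have hβ0 : β ≠ 0 := mul_ne_zero (ENNReal.ofReal_pos.2 (by norm_num)).ne'
    (ENNReal.ofReal_pos.2 (by positivity)).ne'
  by_contra hinf
  -- N tails with Nβ > 1 will contradict the packing bound.
  obtain ⟨N, hN⟩ := ENNReal.exists_nat_mul_gt hβ0 ENNReal.one_ne_top
  obtain ⟨t, ht, rfl⟩ := Set.Infinite.exists_subset_card_eq hinf N
  refine hN.not_ge ?_
  obtain ⟨n, hn⟩ := exists_forall_exists_lt_ne t
  have hcont (τ : ℕ → Fin u) : Continuous (fibreMap f τ n) :=
    continuous_iff_continuousAt.2 fun c => (isHolomorphicAt_fibreMap hf τ n c).1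
  have hopen (τ : ℕ → Fin u) : IsOpen (coordAtSymm v ⁻¹' (fibreMap f τ n ⁻¹' U)) :=
    (hU.preimage (hcont τ)).preimage (isOpenEmbedding_coordAtSymm v).continuous
  refine card_mul_le_one_of_hasLowerDensityAt t
    (A := fun τ => coordAtSymm v ⁻¹' (fibreMap f τ n ⁻¹' U)) (z := coordAt v v)
    (fun τ _ => (hopen τ).measurableSet)
    (fun τ hτ τ' hτ' hττ' =>
      (disjoint_preimage_fibreMap hfU hdisj (hn τ hτ τ' hτ' hττ')).preimage _) fun τ hτ => ?_
  have hol := isHolomorphicAt_fibreMap hf τ n v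
  have hy : fibreMap f τ n v ∈ closure U := juliaSet_subset_closure hf hU hne hfU (ht hτ n)
  have hd := (deriv_chartMap_fibreMap_ne_zero hf hcrit hv (ht hτ) n).2
  have h1 := hasLowerDensityAt_of_sphericalArea hU hα0.le fun r h0 h1 => hα r h0 h1 _ hy
  rw [← chartMap_coordAt] at h1
  have h2 := h1.preimage hol.2.hasStrictDerivAt hd
  -- The density was pulled back by the chart expression, which agrees with the map only near v;
  -- small radii suffice.
  have hev := hol.eventually_eq
  obtain ⟨η, hη, hηsub⟩ := Metric.mem_nhds_iff.1 hev
  filter_upwards [h2, Ioo_mem_nhdsGT hη] with r hr hrη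
  refine hr.trans (MeasureTheory.measure_mono ?_)
  rintro w ⟨hw, hwU⟩
  refine ⟨hw, ?_⟩
  have := hηsub (Metric.ball_subset_ball hrη.2.le hw)
  rw [mem_preimage, mem_preimage, this]
  exact hwU

theorem isOfFiniteType_of_critStar_inter_postcriticalSet {u : ℕ} {f : Fin u → RSphere → RSphere}
    (hf : ∀ i, IsRationalMap (f i)) (hcrit : critStar f ∩ postcriticalSet f = ∅)
    (hNOSC : NiceOpenSetCondition f) : IsOfFiniteType f := by
  have hfin : (⋃ j : Fin u, ⋃ c ∈ {c | IsCriticalPoint (f j) c},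
      (fun τ : ℕ → Fin u => ((fun k => Nat.casesOn k j τ : ℕ → Fin u), c)) ''
        {τ | ∀ n, fibreMap f τ n (f j c) ∈ juliaSet (genSemigroup f)}).Finite := by
    refine finite_iUnion fun j => (hf j).finite_isCriticalPoint.biUnion fun c hc => ?_
    refine (finite_setOf_forall_fibreMap_mem_juliaSet hf hcrit hNOSC ?_).image _
    exact subset_closure ⟨id, Or.inr rfl, j, c, hc, rfl⟩
  refine hfin.subset ?_
  rintro ⟨ω, c⟩ ⟨hJ, hc⟩
  simp only [mem_iUnion]
  refine ⟨ω 0, c, hc, fun k => ω (k + 1), fun n => ?_, ?_⟩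
  -- Time n for the critical value along the tail is time n + 1 for c along ω.
  · exact fibreMap_mem_juliaSet_of_mem_skewJuliaSet hf hJ (n + 1)
  · refine Prod.ext (funext fun k => ?_) rfl
    cases k <;> rfl

end

end RationalSemigroup

theorem lemmal320190325 {u : ℕ} (f : Fin u → RationalSemigroup.RSphere → RationalSemigroup.RSphere)
    (hf : ∀ i, RationalSemigroup.IsRationalMap (f i))
    (hTNR : RationalSemigroup.IsTNR f)
    (hNOSC : RationalSemigroup.NiceOpenSetCondition f) :
    RationalSemigroup.IsOfFiniteType f :=
  RationalSemigroup.isOfFiniteType_of_critStar_inter_postcriticalSet hf hTNR.critStar_inter hNOSC
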